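/- Let $\mathcal A$ be a complex unital Banach algebra with unit $1$. An element $a\in\mathcal A$ is Drazin invertible if there is $b\in\mathcal A$ with $ab=ba$, $bab=b$ and $(a(1-ab))^n=0$ for some integer $n\ge 1$; it is g-Drazin (generalized Drazin) invertible if there is $b\in\mathcal A$ with $ab=ba$, $bab=b$ and $a(1-ab)$ quasinilpotent, that is, of spectral radius $0$. Let $p,q\in\mathcal A$ be idempotents ($p^2=p$, $q^2=q$) and let $m\ge 1$ be an integer. Put $$s_m = p+q-pq+\sum_{k=1}^{m-1}\left((pq)^k p-(pq)^{k+1}\right) = p+q-pq+pqp-(pq)^2+\cdots+(pq)^{m-1}p-(pq)^m$$ (so $s_1=p+q-pq$). Then $s_m$ is Drazin invertible if and only if $1-(pq)^m$ is Drazin invertible, and $s_m$ is g-Drazin invertible if and only if $1-(pq)^m$ is g-Drazin invertible. -/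

import Mathlib

/-- `b` is a Drazin inverse of `a`: `ab = ba`, `bab = b`, and `(a(1 - ab))^n = 0` for some `n`. -/
def IsDrazinInverse {A : Type*} [Ring A] (a b : A) : Prop :=
  a * b = b * a ∧ b * a * b = b ∧ ∃ n : ℕ, 1 ≤ n ∧ (a * (1 - a * b)) ^ n = 0

/-- `a` has a Drazin inverse. -/
def IsDrazinInvertible {A : Type*} [Ring A] (a : A) : Prop :=
  ∃ b : A, IsDrazinInverse a b

/-- `a` is quasinilpotent: its spectral radius is `0`. -/
def IsQuasinilpotent {A : Type*} [NormedRing A] [NormedAlgebra ℂ A] (a : A) : Prop :=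
  spectralRadius ℂ a = 0

/-- `b` is a generalized Drazin inverse of `a`: `ab = ba`, `bab = b`, and `a(1 - ab)` is
quasinilpotent. -/
def IsGDrazinInverse {A : Type*} [NormedRing A] [NormedAlgebra ℂ A] (a b : A) : Prop :=
  a * b = b * a ∧ b * a * b = b ∧ IsQuasinilpotent (a * (1 - a * b))

/-- `a` has a generalized Drazin inverse. -/
def IsGDrazinInvertible {A : Type*} [NormedRing A] [NormedAlgebra ℂ A] (a : A) : Prop :=
  ∃ b : A, IsGDrazinInverse a b

/-- The alternating sum `p + q - pq + pqp - (pq)^2 + ⋯ + (pq)^(m-1) p - (pq)^m`, for `m ≥ 1`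
(for `m = 1` it is `p + q - pq`). -/
def idempotentAlternatingSum {A : Type*} [Ring A] (p q : A) (m : ℕ) : A :=
  p + q - p * q + ∑ k ∈ Finset.Ico 1 m, ((p * q) ^ k * p - (p * q) ^ (k + 1))

/-! Put t = p + pqp + ⋯ + (pq)^(m-1) p. Then s_m = 1 - (1 - t)(1 - q), and Jacobson's lemma (1 - ab
versus 1 - ba) trades s_m for (1 - q)t(1 - q) + q. Dropping the summand q, which is invertible in
the complementary corner, leaves (1 - q)t(1 - q). Since pt = t, Cline's formula (ab versus ba)
passes through t(1 - q) = pt(1 - q) to t(1 - q)p, which telescopes to p - (pq)^m p. Adding 1 - p and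
applying Jacobson again gives 1 - (pq)^m.

Each move uses only a few properties of the residual class, so nilpotents and quasinilpotents are
treated together. -/

/-- The closure properties shared by nilpotent and quasinilpotent elements that are needed
for the theory of (generalized) Drazin inverses. -/
structure NilpotentLike {A : Type*} [Ring A] (N : A → Prop) : Prop where
  mul_swap : ∀ x y, N (x * y) → N (y * x)
  isUnit_one_sub : ∀ x, N x → IsUnit (1 - x)
  idem_mul : ∀ e x, e * e = e → e * x = x * e → N x → N (e * x)
  eq_zero_left : ∀ n z d, N n → z = n * z * d → z = 0
  eq_zero_right : ∀ n z d, N n → z = d * z * n → z = 0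

/-- `a` has a Drazin-type inverse `b` whose residual part `a(1 - ab)` satisfies `N`. -/
def HasDrazinTypeInverse {A : Type*} [Ring A] (N : A → Prop) (a : A) : Prop :=
  ∃ b : A, a * b = b * a ∧ b * a * b = b ∧ N (a * (1 - a * b))

/-! ### Drazin-type inverses in a ring -/

section General

variable {A : Type*} [Ring A] {N : A → Prop}

/-- Cline's formula. -/
theorem HasDrazinTypeInverse.mul_swap (hN : NilpotentLike N) {a b : A}
    (h : HasDrazinTypeInverse N (a * b)) : HasDrazinTypeInverse N (b * a) := by
  obtain ⟨d, h1, h2, h3⟩ := h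
  have hl : (b * a) * (b * d * d * a) = b * d * a := by
    linear_combination (norm := noncomm_ring) b * h1 * d * a + b * h2 * a
  have hr : (b * d * d * a) * (b * a) = b * d * a := by
    linear_combination (norm := noncomm_ring) - b * d * h1 * a + b * h2 * a
  refine ⟨b * d * d * a, hl.trans hr.symm, ?_, ?_⟩
  · rw [hr]
    linear_combination (norm := noncomm_ring) b * h2 * d * a
  · rw [hl]
    have e1 : b * a * (1 - b * d * a) = b * ((1 - a * b * d) * a) := by noncomm_ring
    have e2 : (1 - a * b * d) * a * b = a * b * (1 - a * b * d) := by
      linear_combination (norm := noncomm_ring) a * b * h1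
    rw [e1]
    exact hN.mul_swap _ _ (by rwa [e2])

/-- Jacobson's lemma for Drazin-type inverses. -/
theorem HasDrazinTypeInverse.one_sub_mul_swap (hN : NilpotentLike N) {a b : A}
    (h : HasDrazinTypeInverse N (1 - a * b)) : HasDrazinTypeInverse N (1 - b * a) := by
  obtain ⟨d, h1, h2, h3⟩ := h
  obtain ⟨c, hc⟩ : ∃ c, c = 1 - a * b := ⟨_, rfl⟩
  have hab : a * b = 1 - c := by rw [hc]; noncomm_ring
  rw [← hc] at h1 h2 h3
  obtain ⟨P, hP⟩ : ∃ P, P = 1 - c * d := ⟨_, rfl⟩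
  rw [← hP] at h3
  have hcP : c * P = P * c := by
    rw [hP]; linear_combination (norm := noncomm_ring) -c * h1
  have hdP : d * P = 0 := by
    rw [hP]; linear_combination (norm := noncomm_ring) -h2
  have hPd : P * d = 0 := by
    rw [hP]; linear_combination (norm := noncomm_ring) -h2 - h1 * d
  have hPP : P * P = P := by
    nth_rw 1 [hP]; linear_combination (norm := noncomm_ring) -c * hdP
  obtain ⟨u, hu⟩ := hN.isUnit_one_sub _ h3
  obtain ⟨r, hr⟩ : ∃ r, r = (↑u⁻¹ : A) := ⟨_, rfl⟩
  have hur : (1 - c * P) * r = 1 := by rw [← hu, hr]; exact u.mul_inv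
  have hru : r * (1 - c * P) = 1 := by rw [← hu, hr]; exact u.inv_mul
  have comm : ∀ y, c * P * y = y * (c * P) → y * r = r * y := fun y hy => by
    linear_combination (norm := noncomm_ring) -(hru * y * r) - r * hy * r + r * y * hur
  have hPr : P * r = r * P := comm P (by
    linear_combination (norm := noncomm_ring) hcP * P)
  have hcr : c * r = r * c := comm c (by
    linear_combination (norm := noncomm_ring) -c * hcP)
  -- `t` is the inverse of `1 - c` in the corner of `P`
  obtain ⟨t, ht⟩ : ∃ t, t = P * r := ⟨_, rfl⟩
  have hPt : P * t = t := by
    rw [ht]; linear_combination (norm := noncomm_ring) hPP * r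
  have hct : c * t = t * c := by
    rw [ht]; linear_combination (norm := noncomm_ring) hcP * r + P * hcr
  have htc : t - c * t = P := by
    rw [ht]
    linear_combination (norm := noncomm_ring) P * hur - hcP * P * r + c * hPP * r
  have hdt : d * t = 0 := by
    rw [← hPt]; linear_combination (norm := noncomm_ring) hdP * t
  have htP : t * P = t := by
    rw [ht]; linear_combination (norm := noncomm_ring) -P * hPr + hPP * r
  have hcd : c * d = 1 - P := by rw [hP]; noncomm_ring
  have hdc : d * c = 1 - P := by rw [← h1, hcd]
  -- If `c` were invertible, `1 + b * c⁻¹ * a` would invert `1 - b * a`. In general `d` replaces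
  -- `c⁻¹`, and the `-t` makes `b * t * a` the spectral idempotent.
  have hl : (1 - b * a) * (1 + b * (d - t) * a) = 1 - b * t * a := by
    linear_combination (norm := noncomm_ring)
      -b * hab * (d - t) * a + b * hcd * a + b * htc * a
  have hr' : (1 + b * (d - t) * a) * (1 - b * a) = 1 - b * t * a := by
    linear_combination (norm := noncomm_ring)
      -b * (d - t) * hab * a + b * hdc * a + b * htc * a + b * hct * a
  refine ⟨1 + b * (d - t) * a, hl.trans hr'.symm, ?_, ?_⟩
  · rw [hr']
    have htd : t * d = 0 := by
      rw [← htP]; linear_combination (norm := noncomm_ring) t * hPd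
    have htt : t * t - t * c * t = t := by
      linear_combination (norm := noncomm_ring) t * htc + htP
    have htcd : t * c * d = 0 := by
      linear_combination (norm := noncomm_ring) -hct * d + c * htd
    linear_combination (norm := noncomm_ring)
      -b * t * hab * (d - t) * a - b * htd * a + b * htcd * a + b * htt * a
  · rw [hl]
    have e1 : (1 - b * a) * (1 - (1 - b * t * a)) = b * (c * t * a) := by
      linear_combination (norm := noncomm_ring) -b * hab * t * a
    have e2 : c * t * a * b = c * P := by
      linear_combination (norm := noncomm_ring) c * t * hab + c * htc + c * hct
    rw [e1]
    exact hN.mul_swap _ _ (by rwa [e2])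

/-- A Drazin-type inverse of `a` commutes with everything that commutes with `a`. -/
theorem NilpotentLike.inverse_commute (hN : NilpotentLike N) {a d y : A}
    (h1 : a * d = d * a) (h2 : d * a * d = d) (h3 : N (a * (1 - a * d)))
    (hy : a * y = y * a) : d * y = y * d := by
  obtain ⟨Q, hQ⟩ : ∃ Q, Q = a * d := ⟨_, rfl⟩
  rw [← hQ] at h3
  have hQQ : Q * Q = Q := by
    rw [hQ]; linear_combination (norm := noncomm_ring) a * h2
  have haQ : a * Q = Q * a := by
    rw [hQ]; linear_combination (norm := noncomm_ring) a * h1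
  have hdQ : d * Q = d := by rw [hQ, ← mul_assoc, h2]
  have hQd : Q * d = d := by rw [hQ, h1, h2]
  -- This corner `z` satisfies `z = n * z * d` with `n = a * (1 - Q)` in the residual class.
  have hl : (1 - Q) * y * Q = 0 := by
    refine hN.eq_zero_left _ _ d h3 ?_
    linear_combination (norm := noncomm_ring)
      -a * hQQ * y * Q * d - hy * Q * d + haQ * y * Q * d + Q * hy * Q * d
        - y * haQ * d + Q * y * haQ * d + y * Q * hQ - Q * y * Q * hQ
        - y * hQQ + Q * y * hQQ
  have hr : Q * y * (1 - Q) = 0 := by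
    refine hN.eq_zero_right _ _ d h3 ?_
    linear_combination (norm := noncomm_ring)
      -hQQ * y * (1 - Q) + Q * hQ * y * (1 - Q) + Q * h1 * y * (1 - Q) + hQd * a * y * (1 - Q)
        - hdQ * a * y * (1 - Q) + d * Q * hy * (1 - Q)
        - d * Q * y * a * hQQ - d * Q * y * haQ + d * Q * y * haQ * Q
  have hQy : Q * y = y * Q := by
    linear_combination (norm := noncomm_ring) hr - hl
  linear_combination (norm := noncomm_ring)
    -hdQ * y + d * hQy + d * y * hQ - d * hy * d - h1 * y * d - hQ * y * d + hQy * d + y * hQd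

/-- For `x` in the corner of an idempotent `e`, invertibility of `x` and of `x + (1 - e)` agree. -/
theorem hasDrazinTypeInverse_add_compl_iff (hN : NilpotentLike N) {e x : A} (he : e * e = e)
    (hex : e * x = x) (hxe : x * e = x) :
    HasDrazinTypeInverse N (x + (1 - e)) ↔ HasDrazinTypeInverse N x := by
  constructor
  · rintro ⟨d, h1, h2, h3⟩
    obtain ⟨c, hc⟩ : ∃ c, c = x + (1 - e) := ⟨_, rfl⟩
    rw [← hc] at h1 h2 h3
    have hec : e * c = x := by
      rw [hc]; linear_combination (norm := noncomm_ring) hex - he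
    have hce : c * e = x := by
      rw [hc]; linear_combination (norm := noncomm_ring) hxe - he
    -- `e` commutes with `c`, hence with `d`, so `d` can be cut down to the corner.
    have hde : d * e = e * d := hN.inverse_commute h1 h2 h3 (hce.trans hec.symm)
    have hl : x * (e * d) = e * (c * d) := by
      rw [← mul_assoc, hxe, ← mul_assoc, hec]
    have hr : (e * d) * x = e * (c * d) := by
      rw [← hce]
      linear_combination (norm := noncomm_ring)
        e * d * hce - e * d * hec + e * hde * c + he * d * c - e * h1
    refine ⟨e * d, hl.trans hr.symm, ?_, ?_⟩
    · rw [hr]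
      linear_combination (norm := noncomm_ring)
        e * c * hde * d + e * hce * d * d - e * hec * d * d + he * c * d * d + e * h1 * d + e * h2
    · rw [hl]
      have e1 : x * (1 - e * (c * d)) = e * (c * (1 - c * d)) := by
        linear_combination (norm := noncomm_ring) -hec - hxe * c * d + hec * c * d
      rw [e1]
      refine hN.idem_mul _ _ he ?_ h3
      linear_combination (norm := noncomm_ring)
        hec - hce - hec * c * d + hce * c * d + c * hce * d - c * hec * d + c * c * hde
  · rintro ⟨d, h1, h2, h3⟩
    have hed : e * d = d := by
      linear_combination (norm := noncomm_ring)
        -e * h2 - e * h1 * d + hex * d * d + h1 * d + h2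
    have hde : d * e = d := by
      linear_combination (norm := noncomm_ring)
        -h2 * e + d * h1 * e + d * d * hxe - d * h1 + h2
    have hl : (x + (1 - e)) * (d + (1 - e)) = x * d + (1 - e) := by
      linear_combination (norm := noncomm_ring) -hxe - hed + he
    have hr : (d + (1 - e)) * (x + (1 - e)) = x * d + (1 - e) := by
      linear_combination (norm := noncomm_ring) -hde - hex + he - h1
    refine ⟨d + (1 - e), hl.trans hr.symm, ?_, ?_⟩
    · rw [hr]
      linear_combination (norm := noncomm_ring) h1 * d + h2 - x * hde - hed + he
    · have e1 : (x + (1 - e)) * (1 - (x + (1 - e)) * (d + (1 - e))) = x * (1 - x * d) := by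
        rw [hl]
        linear_combination (norm := noncomm_ring) hxe + hex * d - he
      rwa [e1]

/-- The chain of equivalences relating the alternating sum to `1 - (pq)^m`. -/
theorem hasDrazinTypeInverse_idempotentAlternatingSum_iff (hN : NilpotentLike N) {p q : A}
    (hp : p * p = p) (hq : q * q = q) {m : ℕ} (hm : 1 ≤ m) :
    HasDrazinTypeInverse N (idempotentAlternatingSum p q m) ↔
      HasDrazinTypeInverse N (1 - (p * q) ^ m) := by
  have cline : ∀ a b : A, HasDrazinTypeInverse N (a * b) ↔ HasDrazinTypeInverse N (b * a) :=
    fun _ _ => ⟨.mul_swap hN, .mul_swap hN⟩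
  have jacobson : ∀ a b : A,
      HasDrazinTypeInverse N (1 - a * b) ↔ HasDrazinTypeInverse N (1 - b * a) :=
    fun _ _ => ⟨.one_sub_mul_swap hN, .one_sub_mul_swap hN⟩
  obtain ⟨t, ht⟩ : ∃ t, t = ∑ k ∈ Finset.range m, (p * q) ^ k * p := ⟨_, rfl⟩
  have hpow : ∀ k, p * ((p * q) ^ k * p) = (p * q) ^ k * p := by
    intro k
    cases k with
    | zero => simp [hp]
    | succ k => rw [pow_succ']; simp only [← mul_assoc, hp]
  have hpt : p * t = t := by
    rw [ht, Finset.mul_sum]; exact Finset.sum_congr rfl fun k _ => hpow k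
  have hs : idempotentAlternatingSum p q m = 1 - (1 - t) * (1 - q) := by
    have h : ∑ k ∈ Finset.range m, ((p * q) ^ k * p - (p * q) ^ (k + 1)) = t - t * q := by
      rw [ht, Finset.sum_mul, ← Finset.sum_sub_distrib]
      exact Finset.sum_congr rfl fun k _ => by rw [pow_succ, mul_assoc _ p q]
    -- The `k = 0` term is `p - p * q`.
    rw [Finset.range_eq_Ico, Finset.sum_eq_sum_Ico_succ_bot hm] at h
    rw [idempotentAlternatingSum]
    simp only [pow_zero, one_mul, zero_add, pow_one] at h
    linear_combination (norm := noncomm_ring) h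
  have htp : t * (1 - q) * p = p - (p * q) ^ m * p := by
    have h := Finset.sum_range_sub' (fun k => (p * q) ^ k * p) m
    simp only [pow_zero, one_mul] at h
    rw [← h, ht, Finset.sum_mul, Finset.sum_mul]
    refine Finset.sum_congr rfl fun k _ => ?_
    rw [pow_succ]
    linear_combination (norm := noncomm_ring) (p * q) ^ k * hp
  have he : (1 - q) * (1 - q) = 1 - q := by
    linear_combination (norm := noncomm_ring) hq
  have e1 : 1 - (1 - q) * (1 - t) * (1 - q) = (1 - q) * (t * (1 - q)) + (1 - (1 - q)) := by
    linear_combination (norm := noncomm_ring) -he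
  have e2 : 1 - (p * q) ^ m * p = (p - (p * q) ^ m * p) + (1 - p) := by noncomm_ring
  have hpm : p * (p * q) ^ m = (p * q) ^ m := by
    obtain ⟨k, rfl⟩ : ∃ k, m = k + 1 := ⟨m - 1, by omega⟩
    rw [pow_succ']; simp only [← mul_assoc, hp]
  calc HasDrazinTypeInverse N (idempotentAlternatingSum p q m)
      ↔ HasDrazinTypeInverse N (1 - (1 - t) * (1 - q) * (1 - q)) := by
        rw [hs, mul_assoc _ (1 - q), he]
    _ ↔ HasDrazinTypeInverse N ((1 - q) * (t * (1 - q)) + (1 - (1 - q))) := by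
        rw [jacobson, ← e1, ← mul_assoc]
    _ ↔ HasDrazinTypeInverse N ((1 - q) * (t * (1 - q))) :=
        hasDrazinTypeInverse_add_compl_iff hN he (by rw [← mul_assoc, he])
          (by rw [mul_assoc, mul_assoc t, he])
    _ ↔ HasDrazinTypeInverse N (p * (t * (1 - q))) := by
        rw [cline, mul_assoc, he, ← mul_assoc p, hpt]
    _ ↔ HasDrazinTypeInverse N (p - (p * q) ^ m * p) := by rw [cline, htp]
    _ ↔ HasDrazinTypeInverse N (1 - (p * q) ^ m * p) := by
        rw [e2]
        exact (hasDrazinTypeInverse_add_compl_iff hN hp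
          (by rw [mul_sub, hp, hpow]) (by rw [sub_mul, mul_assoc _ p, hp])).symm
    _ ↔ HasDrazinTypeInverse N (1 - (p * q) ^ m) := by rw [jacobson, hpm]

end General

/-! ### Nilpotent and quasinilpotent residuals -/

theorem eq_pow_mul_mul_pow {M : Type*} [Monoid M] {x y z : M} (h : z = x * z * y) (k : ℕ) :
    z = x ^ k * z * y ^ k := by
  induction k with
  | zero => simp
  | succ k ih =>
    calc z = x * z * y := h
      _ = x * (x ^ k * z * y ^ k) * y := by rw [← ih]
      _ = x ^ (k + 1) * z * y ^ (k + 1) := by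
        rw [pow_succ' x, pow_succ y]; simp only [mul_assoc]

theorem nilpotentLike_pow_eq_zero {A : Type*} [Ring A] :
    NilpotentLike fun x : A => ∃ n : ℕ, 1 ≤ n ∧ x ^ n = 0 where
  mul_swap x y := by
    rintro ⟨n, -, h⟩
    refine ⟨n + 1, by omega, ?_⟩
    have : (y * x) ^ (n + 1) = y * (x * y) ^ n * x := by
      clear h
      induction n with
      | zero => simp
      | succ n ih => rw [pow_succ, ih, pow_succ (x * y)]; simp only [mul_assoc]
    rw [this, h, mul_zero, zero_mul]
  isUnit_one_sub x := fun ⟨n, _, h⟩ => IsNilpotent.isUnit_one_sub ⟨n, h⟩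
  idem_mul e x _ hex := fun ⟨n, hn, h⟩ =>
    ⟨n, hn, by rw [Commute.mul_pow (show Commute e x from hex), h, mul_zero]⟩
  eq_zero_left x z d := fun ⟨n, _, h⟩ hz => by
    rw [eq_pow_mul_mul_pow hz n, h, zero_mul, zero_mul]
  eq_zero_right x z d := fun ⟨n, _, h⟩ hz => by
    rw [eq_pow_mul_mul_pow hz n, h, mul_zero]

/-- The inverse is that of `c - x` on the corner of `e` and `c'` on its complement. With `c` a
nonzero scalar, it shows that multiplying by `e` creates no new nonzero spectrum. -/
theorem IsUnit.sub_idem_mul {A : Type*} [Ring A] {c c' e x : A} (hu : IsUnit (c - x))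
    (he : e * e = e) (hex : e * x = x * e) (hc : ∀ y, c * y = y * c) (hc' : ∀ y, c' * y = y * c')
    (hcc' : c * c' = 1) (hc'c : c' * c = 1) : IsUnit (c - e * x) := by
  obtain ⟨u, hu⟩ := hu
  obtain ⟨v, hv⟩ : ∃ v, v = (↑u⁻¹ : A) := ⟨_, rfl⟩
  have hl : (c - x) * v = 1 := by rw [← hu, hv]; exact u.mul_inv
  have hr : v * (c - x) = 1 := by rw [← hu, hv]; exact u.inv_mul
  have hev : e * v = v * e := by
    linear_combination (norm := noncomm_ring)
      -(hr * e * v) + v * e * hl + v * hc e * v + v * hex * v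
  refine ⟨⟨c - e * x, e * v + (1 - e) * c', ?_, ?_⟩, rfl⟩
  · linear_combination (norm := noncomm_ring)
      e * hl + hc e * v + (1 - e) * hcc' - hc e * c' + e * hex * v - he * x * v
        - e * hex * c' + he * x * c'
  · linear_combination (norm := noncomm_ring)
      e * hr + e * hev * x - he * v * x + (1 - e) * hc'c - (1 - e) * hc' e * x + he * c' * x

section Banach

variable {A : Type*} [NormedRing A] [NormedAlgebra ℂ A]

theorem isQuasinilpotent_iff {a : A} :
    IsQuasinilpotent a ↔ ∀ k ∈ spectrum ℂ a, k = 0 := by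
  simp [IsQuasinilpotent, spectralRadius]

/-- Gelfand's formula: `‖a ^ n‖ ^ (1 / n)` tends to 0. -/
theorem IsQuasinilpotent.eventually_norm_pow_le [CompleteSpace A] {a : A}
    (ha : IsQuasinilpotent a) {c : ℝ} (hc : 0 < c) :
    ∀ᶠ n : ℕ in Filter.atTop, ‖a ^ n‖ ≤ c ^ n := by
  have h := spectrum.pow_norm_pow_one_div_tendsto_nhds_spectralRadius a
  rw [show spectralRadius ℂ a = 0 from ha] at h
  filter_upwards [h.eventually (gt_mem_nhds (ENNReal.ofReal_pos.2 hc)),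
    Filter.eventually_ge_atTop 1] with n hn h1
  have hlt := (ENNReal.ofReal_lt_ofReal_iff hc).1 hn
  have hn0 : n ≠ 0 := by omega
  calc ‖a ^ n‖ = (‖a ^ n‖ ^ (1 / n : ℝ)) ^ n := by
        rw [one_div, Real.rpow_inv_natCast_pow (norm_nonneg _) hn0]
    _ ≤ c ^ n := pow_le_pow_left₀ (by positivity) hlt.le n

theorem IsQuasinilpotent.tendsto_norm_pow_mul_pow [CompleteSpace A] {a : A}
    (ha : IsQuasinilpotent a) (d : A) (C : ℝ) :
    Filter.Tendsto (fun n : ℕ => ‖a ^ n‖ * C * ‖d ^ n‖) Filter.atTop (nhds 0) := by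
  have hd : 0 < 2 * (‖d‖ + 1) := by positivity
  have hlim : Filter.Tendsto (fun n : ℕ => (1 / 2 : ℝ) ^ n * |C|) Filter.atTop (nhds 0) := by
    simpa using (tendsto_pow_atTop_nhds_zero_of_lt_one (r := (1 / 2 : ℝ))
      (by norm_num) (by norm_num)).mul_const |C|
  refine squeeze_zero_norm' ?_ hlim
  -- The rate `(2 * (‖d‖ + 1))⁻¹` beats the growth of `‖d ^ n‖` by a factor `2 ^ n`.
  filter_upwards [ha.eventually_norm_pow_le (inv_pos.2 hd), Filter.eventually_ge_atTop 1]
    with n hn h1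
  have hdn : ‖d ^ n‖ ≤ (‖d‖ + 1) ^ n :=
    (norm_pow_le' d h1).trans (pow_le_pow_left₀ (norm_nonneg _) (by linarith) n)
  rw [norm_mul, norm_mul, norm_norm, norm_norm, Real.norm_eq_abs]
  calc ‖a ^ n‖ * |C| * ‖d ^ n‖ ≤ (2 * (‖d‖ + 1))⁻¹ ^ n * |C| * (‖d‖ + 1) ^ n := by gcongr
    _ = ((2 * (‖d‖ + 1))⁻¹ * (‖d‖ + 1)) ^ n * |C| := by rw [mul_pow]; ring
    _ = (1 / 2 : ℝ) ^ n * |C| := by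
      congr 2
      have : ‖d‖ + 1 ≠ 0 := by positivity
      field_simp

theorem nilpotentLike_isQuasinilpotent [CompleteSpace A] :
    NilpotentLike (IsQuasinilpotent : A → Prop) where
  mul_swap x y h := by
    rw [isQuasinilpotent_iff] at h ⊢
    intro k hk
    by_contra hk0
    have : k ∈ spectrum ℂ (y * x) \ {0} := ⟨hk, hk0⟩
    rw [spectrum.nonzero_mul_comm] at this
    exact hk0 (h k this.1)
  isUnit_one_sub x h := by
    rw [isQuasinilpotent_iff] at h
    have : (1 : ℂ) ∉ spectrum ℂ x := fun h1 => one_ne_zero (h 1 h1)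
    simpa using spectrum.notMem_iff.1 this
  idem_mul e x he hex h := by
    rw [isQuasinilpotent_iff] at h ⊢
    intro k hk
    by_contra hk0
    refine hk ?_
    have hu : IsUnit (algebraMap ℂ A k - x) := spectrum.notMem_iff.1 fun hk' => hk0 (h k hk')
    exact hu.sub_idem_mul he hex (Algebra.commutes k) (Algebra.commutes k⁻¹)
      (by rw [← map_mul, mul_inv_cancel₀ hk0, map_one])
      (by rw [← map_mul, inv_mul_cancel₀ hk0, map_one])
  eq_zero_left x z d hx hz := by
    refine norm_le_zero_iff.1 (ge_of_tendsto' (hx.tendsto_norm_pow_mul_pow d ‖z‖) fun n => ?_)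
    conv_lhs => rw [eq_pow_mul_mul_pow hz n]
    exact (norm_mul_le _ _).trans (by gcongr; exact norm_mul_le _ _)
  eq_zero_right x z d hx hz := by
    refine norm_le_zero_iff.1 (ge_of_tendsto' (hx.tendsto_norm_pow_mul_pow d ‖z‖) fun n => ?_)
    conv_lhs => rw [eq_pow_mul_mul_pow hz n]
    refine (norm_mul_le _ _).trans ?_
    calc ‖d ^ n * z‖ * ‖x ^ n‖ ≤ ‖d ^ n‖ * ‖z‖ * ‖x ^ n‖ := by gcongr; exact norm_mul_le _ _
      _ = ‖x ^ n‖ * ‖z‖ * ‖d ^ n‖ := by ring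

end Banach

theorem corollary3p2 {A : Type*} [NormedRing A] [NormedAlgebra ℂ A] [CompleteSpace A]
    (p q : A) (hp : IsIdempotentElem p) (hq : IsIdempotentElem q) (m : ℕ) (hm : 1 ≤ m) :
    (IsDrazinInvertible (idempotentAlternatingSum p q m) ↔
        IsDrazinInvertible (1 - (p * q) ^ m)) ∧
      (IsGDrazinInvertible (idempotentAlternatingSum p q m) ↔
        IsGDrazinInvertible (1 - (p * q) ^ m)) :=
  ⟨hasDrazinTypeInverse_idempotentAlternatingSum_iff nilpotentLike_pow_eq_zero hp hq hm,
    hasDrazinTypeInverse_idempotentAlternatingSum_iff nilpotentLike_isQuasinilpotent hp hq hm⟩
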